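/- Let $d,n\ge 1$ and $1\le k\le d$ be integers and let $p\ge 1$ be real. Let $\mathbb S_{d,k}=\{E\in\mathbb R^{d\times k}:E^\top E=I_k\}$, equipped with its uniform distribution $\varsigma$ (the law of the first $k$ columns of a Haar-distributed orthogonal $d\times d$ matrix), let $\|\cdot\|$ denote the Euclidean norm, and for a Borel probability measure $\mu$ on $\mathbb R^d$ let $E^\star_{\#}\mu$ be the push-forward of $\mu$ under $x\mapsto E^\top x$. Let $\mathcal W_p(\mu,\nu)=\bigl(\inf_{\pi}\int\|x-y\|^p\,d\pi(x,y)\bigr)^{1/p}$, the infimum being over all couplings $\pi$ of $\mu$ and $\nu$, and define $$\overline{\mathcal{PW}}_{p,k}(\mu,\nu)=\sup_{E\in\mathbb S_{d,k}}\mathcal W_p(E^\star_{\#}\mu,E^\star_{\#}\nu),\qquad \underline{\mathcal{PW}}_{p,k}(\mu,\nu)=\Bigl(\int_{\mathbb S_{d,k}}\mathcal W_p^p(E^\star_{\#}\mu,E^\star_{\#}\nu)\,d\varsigma(E)\Bigr)^{1/p}$$ (the PRW and the IPRW distance). Let $\mu_\star$ be a Borel probability measure on $\mathbb R^d$ that satisfies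 the Bernstein tail condition with constants $\sigma,V>0$: $$\mathbb E_{X\sim\mu_\star}\Bigl[\sup_{E\in\mathbb S_{d,k}}\|E^\top X\|^r\Bigr]\le \tfrac12\sigma^2\,r!\,V^{r-2}\qquad\text{for all integers } r\ge 2 .$$ Let $X_1,\dots,X_n$ be independent random vectors with law $\mu_\star$ and let $\widehat\mu_n=\frac1n\sum_{i=1}^n\delta_{X_i}$. Then for both $W=\underline{\mathcal{PW}}_{p,k}$ and $W=\overline{\mathcal{PW}}_{p,k}$ the random variable $W(\widehat\mu_n,\mu_\star)$ is finite and integrable, and for all $t\ge 0$, $$\mathbb P\bigl(|W(\widehat\mu_n,\mu_\star)-\mathbb E[W(\widehat\mu_n,\mu_\star)]|\ge t\bigr)\le 2\exp\left(-\frac{t^2}{8\sigma^2 n^{1-2/p}+4tVn^{-1/p}}\right).$$ -/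

import Mathlib

open MeasureTheory ProbabilityTheory
open scoped ENNReal Matrix

noncomputable section

namespace ProjOT

/-! ### Wasserstein distance -/

/-- The couplings of two measures: measures on the product with marginals `μ` and `ν`. -/
def couplings {F : Type*} [MeasurableSpace F] (μ ν : Measure F) : Set (Measure (F × F)) :=
  {π | π.map Prod.fst = μ ∧ π.map Prod.snd = ν}

/-- The Wasserstein distance of order `p`, with values in `[0, ∞]`. -/
def wasserstein {F : Type*} [PseudoEMetricSpace F] [MeasurableSpace F]
    (p : ℝ) (μ ν : Measure F) : ℝ≥0∞ :=
  (⨅ π ∈ couplings μ ν, ∫⁻ z, edist z.1 z.2 ^ p ∂π) ^ (1 / p)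

/-! ### Orthonormal frames and the uniform distribution on them -/

/-- The set of `d × k` real matrices with orthonormal columns, `Eᵀ E = I_k`. -/
def stiefel (d k : ℕ) : Set (Matrix (Fin d) (Fin k) ℝ) :=
  {E | Eᵀ * E = 1}

/-- The linear map `x ↦ Eᵀ x` from `ℝ^d` to `ℝ^k` (Euclidean spaces). -/
def proj {d k : ℕ} (E : Matrix (Fin d) (Fin k) ℝ) :
    EuclideanSpace ℝ (Fin d) →ₗ[ℝ] EuclideanSpace ℝ (Fin k) :=
  Matrix.toEuclideanLin Eᵀ

/-- Matrices carry the Borel σ-algebra (equivalently the product one). -/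
instance matrixMeasurableSpace (m n : ℕ) : MeasurableSpace (Matrix (Fin m) (Fin n) ℝ) :=
  borel _

instance matrixBorelSpace (m n : ℕ) : BorelSpace (Matrix (Fin m) (Fin n) ℝ) := ⟨rfl⟩

instance orthogonalGroupIsTopologicalGroup (d : ℕ) :
    IsTopologicalGroup (Matrix.orthogonalGroup (Fin d) ℝ) :=
  inferInstanceAs (IsTopologicalGroup (unitary (Matrix (Fin d) (Fin d) ℝ)))

instance orthogonalGroupCompactSpace (d : ℕ) :
    CompactSpace (Matrix.orthogonalGroup (Fin d) ℝ) := by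
  refine isCompact_iff_compactSpace.mp (?_ : IsCompact
    (Matrix.orthogonalGroup (Fin d) ℝ : Set (Matrix (Fin d) (Fin d) ℝ)))
  have hK : IsCompact (Set.univ.pi fun _ : Fin d => Set.univ.pi fun _ : Fin d =>
      Set.Icc (-1 : ℝ) 1) :=
    isCompact_univ_pi fun _ => isCompact_univ_pi fun _ => isCompact_Icc
  refine hK.of_isClosed_subset ?_ ?_
  · have : ((Matrix.orthogonalGroup (Fin d) ℝ : Set (Matrix (Fin d) (Fin d) ℝ))) =
        {A | A * star A = 1} := by
      ext A
      exact Matrix.mem_orthogonalGroup_iff (Fin d) ℝ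
    rw [this]
    exact isClosed_eq (by fun_prop) continuous_const
  · intro U hU i _ j _
    have h := entry_norm_bound_of_unitary (𝕜 := ℝ) hU i j
    exact abs_le.mp h

/-- The Haar probability measure on the orthogonal group `O(d)`. -/
def haarOrthogonal (d : ℕ) : Measure (Matrix.orthogonalGroup (Fin d) ℝ) :=
  Measure.haarMeasure ⊤

/-- The uniform distribution on `stiefel d k`, as a measure on `d × k` matrices: the law of the
first `k` columns of a Haar distributed orthogonal `d × d` matrix. -/
def stiefelUniform {d k : ℕ} (hk : k ≤ d) : Measure (Matrix (Fin d) (Fin k) ℝ) :=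
  (haarOrthogonal d).map fun U : Matrix.orthogonalGroup (Fin d) ℝ =>
    (U : Matrix (Fin d) (Fin d) ℝ).submatrix id (Fin.castLE hk)

/-! ### Projected Wasserstein distances -/

/-- The projection robust Wasserstein distance of order `p` with projection dimension `k`. -/
def prw {d : ℕ} (p : ℝ) (k : ℕ) (μ ν : Measure (EuclideanSpace ℝ (Fin d))) : ℝ≥0∞ :=
  ⨆ E ∈ stiefel d k, wasserstein p (μ.map (proj E)) (ν.map (proj E))

/-- The integral projection robust Wasserstein distance of order `p` with projection
dimension `k ≤ d`. -/
def iprw {d k : ℕ} (p : ℝ) (hk : k ≤ d) (μ ν : Measure (EuclideanSpace ℝ (Fin d))) : ℝ≥0∞ :=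
  (∫⁻ E, wasserstein p (μ.map (proj E)) (ν.map (proj E)) ^ p ∂stiefelUniform hk) ^ (1 / p)

/-! ### Empirical measures and the tail condition -/

/-- The empirical measure `(1/n) ∑ δ_{x_i}`. -/
def empiricalMeasure {F : Type*} [MeasurableSpace F] {n : ℕ} (x : Fin n → F) : Measure F :=
  (n : ℝ≥0∞)⁻¹ • ∑ i, Measure.dirac (x i)

/-- The Bernstein tail condition with constants `σ, V > 0`:
`𝔼 sup_E ‖Eᵀ X‖^r ≤ (1/2) σ² r! V^(r-2)` for all integers `r ≥ 2`. -/
def BernsteinTail {d : ℕ} (k : ℕ) (σ V : ℝ) (μ : Measure (EuclideanSpace ℝ (Fin d))) : Prop :=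
  0 < σ ∧ 0 < V ∧ ∀ r : ℕ, 2 ≤ r →
    ∫⁻ x, ⨆ E ∈ stiefel d k, ‖proj E x‖ₑ ^ r ∂μ ≤
      ENNReal.ofReal (1 / 2 * σ ^ 2 * (r.factorial : ℝ) * V ^ (r - 2))

end ProjOT

end

namespace ProjOT

/-! Fix `μ` and regard the distance as a function of the sample `x`. Moving the atoms of the
empirical measure while keeping the rest of a coupling costs at most `(n⁻¹ ∑ ‖x i - x' i‖ ^ p) ^
(1/p)` after any projection, since `x ↦ Eᵀ x` is a contraction. As the `ℓ^p` norm is at most the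
`ℓ^1` norm, both distances are Lipschitz in the sample for `∑ ‖x i - x' i‖`, with constant `c = n ^
(-1/p)` (`wasserstein_proj_empiricalMeasure_le`, `prw_le_add`, `iprw_le_add`).

The rest is a Bernstein inequality for such functions `f` of independent vectors. In one variable,
Jensen replaces the mean by an independent copy, and symmetry removes the linear term of the
exponential, so that only moments of order at least 2 of `c ‖a - b‖` enter
(`lintegral_exp_sub_integral_le`). Those moments are of Bernstein type with constants `2cσ` and
`2cV`. Integrating out one coordinate at a time preserves the Lipschitz bound, so the
exponential-moment bounds multiply (`lintegral_pi_exp_sub_integral_le`), and Chernoff's method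
finishes. With `n c² = n ^ (1 - 2/p)` the constants are those claimed. -/

/-! ### Projections and the moments of the norm. -/

/-- Pythagoras: with `y = Eᵀ x`, expanding `0 ≤ ‖x - E y‖²` gives `‖x‖² - ‖y‖²`. -/
lemma norm_proj_le {d k : ℕ} {E : Matrix (Fin d) (Fin k) ℝ} (hE : E ∈ stiefel d k)
    (x : EuclideanSpace ℝ (Fin d)) : ‖proj E x‖ ≤ ‖x‖ := by
  have hE' : Eᵀ * E = 1 := hE
  set y : Fin k → ℝ := Eᵀ *ᵥ x.ofLp with hy
  have h1 : y ⬝ᵥ y = x.ofLp ⬝ᵥ (E *ᵥ y) := by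
    conv_lhs => rw [hy, Matrix.mulVec_transpose, ← Matrix.dotProduct_mulVec,
      ← Matrix.mulVec_transpose, ← hy]
  have h2 : (E *ᵥ y) ⬝ᵥ (E *ᵥ y) = y ⬝ᵥ y := by
    rw [Matrix.dotProduct_mulVec, Matrix.vecMul_mulVec, ← Matrix.dotProduct_mulVec, hE',
      Matrix.one_mulVec]
  have h3 : 0 ≤ (x.ofLp - E *ᵥ y) ⬝ᵥ (x.ofLp - E *ᵥ y) :=
    Finset.sum_nonneg fun i _ => mul_self_nonneg _
  have h4 : y ⬝ᵥ y ≤ x.ofLp ⬝ᵥ x.ofLp := by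
    rw [sub_dotProduct, dotProduct_sub, dotProduct_sub, h2,
      dotProduct_comm (E *ᵥ y) x.ofLp, ← h1] at h3
    linarith
  have h5 : ∀ {m : ℕ} (z : EuclideanSpace ℝ (Fin m)), ‖z‖ = √(z.ofLp ⬝ᵥ z.ofLp) := by
    intro m z
    rw [EuclideanSpace.norm_eq]
    simp [dotProduct, sq]
  rw [h5, h5]
  exact Real.sqrt_le_sqrt h4

/-- A frame whose first column is `x / ‖x‖` loses nothing of `x`. Hence the supremum in the tail
condition dominates `‖x‖ ^ r`, and the condition bounds the moments of the norm itself. -/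
lemma exists_mem_stiefel_norm_le_norm_proj {d k : ℕ} (hk1 : 1 ≤ k) (hkd : k ≤ d)
    (x : EuclideanSpace ℝ (Fin d)) : ∃ E ∈ stiefel d k, ‖x‖ ≤ ‖proj E x‖ := by
  let i₀ : Fin d := Fin.castLE hkd ⟨0, hk1⟩
  let v : Fin d → EuclideanSpace ℝ (Fin d) := fun _ => (‖x‖⁻¹ : ℝ) • x
  -- For `x = 0` this set is empty, so the basis extension below covers that case too.
  let s : Set (Fin d) := {i | i = i₀ ∧ x ≠ 0}
  have hv : Orthonormal ℝ (s.domRestrict v) := by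
    constructor
    · rintro ⟨i, hi, hx⟩
      simp [v, Set.domRestrict, norm_smul, hx]
    · rintro ⟨i, hi, hx⟩ ⟨j, hj, hx'⟩ hij
      exact absurd (Subtype.ext (hi.trans hj.symm)) hij
  obtain ⟨b, hb⟩ := hv.exists_orthonormalBasis_extension_of_card_eq (by simp)
  refine ⟨Matrix.of fun i j => b (Fin.castLE hkd j) i, ?_, ?_⟩
  · ext j l
    have h := orthonormal_iff_ite.mp b.orthonormal (Fin.castLE hkd l) (Fin.castLE hkd j)
    rw [PiLp.inner_apply] at h
    simp only [Matrix.mul_apply, Matrix.transpose_apply, Matrix.one_apply]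
    refine (Eq.trans ?_ h).trans ?_
    · simp
    · simp [Fin.ext_iff, eq_comm]
  · rcases eq_or_ne x 0 with rfl | hx
    · simp
    have hbx : b i₀ = (‖x‖⁻¹ : ℝ) • x := hb i₀ ⟨rfl, hx⟩
    refine le_trans (le_of_eq ?_) (PiLp.norm_apply_le _ (⟨0, hk1⟩ : Fin k))
    have : (proj (Matrix.of fun i j => b (Fin.castLE hkd j) i) x)
        (⟨0, hk1⟩ : Fin k) = inner ℝ x (b i₀) := by
      rw [PiLp.inner_apply]
      simp [proj, Matrix.mulVec, dotProduct, i₀, Matrix.toLpLin_apply]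
    rw [this, hbx, inner_smul_right, real_inner_self_eq_norm_sq]
    have := norm_pos_iff.mpr hx
    rw [sq, inv_mul_cancel_left₀ this.ne', norm_norm]

lemma BernsteinTail.lintegral_enorm_pow_le {d k : ℕ} (hk1 : 1 ≤ k) (hkd : k ≤ d) {σ V : ℝ}
    {μ : Measure (EuclideanSpace ℝ (Fin d))} (h : BernsteinTail k σ V μ) {r : ℕ} (hr : 2 ≤ r) :
    ∫⁻ x, ‖x‖ₑ ^ r ∂μ ≤ ENNReal.ofReal (1 / 2 * σ ^ 2 * (r.factorial : ℝ) * V ^ (r - 2)) := by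
  refine le_trans (lintegral_mono fun x => ?_) (h.2.2 r hr)
  obtain ⟨E, hE, hx⟩ := exists_mem_stiefel_norm_le_norm_proj hk1 hkd x
  refine le_iSup₂_of_le E hE ?_
  gcongr
  simpa [← ofReal_norm] using ENNReal.ofReal_le_ofReal hx

/-! ### The Wasserstein distance to an empirical measure -/

lemma empiricalMeasure_map {F G : Type*} [MeasurableSpace F] [MeasurableSpace G] {n : ℕ}
    (x : Fin n → F) {g : F → G} (hg : Measurable g) :
    (empiricalMeasure x).map g = empiricalMeasure fun i => g (x i) := by
  ext s hs
  rw [Measure.map_apply hg hs]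
  simp [empiricalMeasure, Measure.dirac_apply' _ hs, Measure.dirac_apply' _ (hg hs)]
  rfl

lemma isProbabilityMeasure_empiricalMeasure {F : Type*} [MeasurableSpace F] {n : ℕ} (hn : 1 ≤ n)
    (x : Fin n → F) : IsProbabilityMeasure (empiricalMeasure x) := by
  constructor
  simp only [empiricalMeasure, Measure.smul_apply, Measure.finsetSum_apply, measure_univ]
  simp only [Finset.sum_const, Finset.card_univ, Fintype.card_fin, nsmul_eq_mul, mul_one,
    smul_eq_mul]
  exact ENNReal.inv_mul_cancel (by simp; omega) (by simp)

lemma lintegral_empiricalMeasure {F : Type*} [MeasurableSpace F] {n : ℕ}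
    (x : Fin n → F) {g : F → ℝ≥0∞} (hg : Measurable g) :
    ∫⁻ y, g y ∂empiricalMeasure x = (n : ℝ≥0∞)⁻¹ * ∑ i, g (x i) := by
  simp [empiricalMeasure, lintegral_finsetSum_measure, lintegral_dirac' _ hg]

/-- A triangle inequality by explicit gluing: a coupling of the empirical measure of `x'` with `ν`
is lifted to a law of pairs (index, point), after which `x' i` can be exchanged for `x i` and
Minkowski applies. -/
lemma wasserstein_empiricalMeasure_le {F : Type*} [PseudoEMetricSpace F] [MeasurableSpace F]
    [OpensMeasurableSpace F] [SecondCountableTopology F] [StandardBorelSpace F] [Nonempty F]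
    {p : ℝ} (hp : 1 ≤ p) {n : ℕ} (hn : 1 ≤ n) (x x' : Fin n → F) (ν : Measure F) :
    wasserstein p (empiricalMeasure x) ν ≤ wasserstein p (empiricalMeasure x') ν +
      ((n : ℝ≥0∞)⁻¹ * ∑ i, edist (x i) (x' i) ^ p) ^ (1 / p) := by
  have hp0 : 0 < p := by linarith
  rw [← tsub_le_iff_right]
  set c := ((n : ℝ≥0∞)⁻¹ * ∑ i, edist (x i) (x' i) ^ p) ^ (1 / p) with hc
  conv_rhs => unfold wasserstein
  rw [one_div, ENNReal.le_rpow_inv_iff hp0]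
  refine le_iInf₂ fun π hπ => ?_
  rw [← ENNReal.le_rpow_inv_iff hp0, ← one_div, tsub_le_iff_right]
  have hx : Measurable x := measurable_of_finite x
  have hx' : Measurable x' := measurable_of_finite x'
  have : IsProbabilityMeasure (π.map Prod.fst) := by
    rw [hπ.1]; exact isProbabilityMeasure_empiricalMeasure hn x'
  have hπp : IsProbabilityMeasure π :=
    Measure.isProbabilityMeasure_of_map (f := Prod.fst)
  let τ : Measure (Fin n) := empiricalMeasure id
  have : IsProbabilityMeasure τ := isProbabilityMeasure_empiricalMeasure hn id
  -- A uniform index `i`, then a point drawn from the conditional law of `π` given first coordinate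
  -- `x' i`. Repeated values among the `x' i` do no harm.
  let ρ : Measure (Fin n × F) := τ ⊗ₘ (π.condKernel.comap x' hx')
  have hρ : ρ.map (Prod.map x' id) = π := by
    conv_rhs => rw [← π.disintegrate π.condKernel]
    have hfst : π.fst = τ.map x' := by
      rw [Measure.fst, hπ.1, empiricalMeasure_map _ hx']; rfl
    rw [hfst]
    refine Measure.ext_of_lintegral _ fun g hg => ?_
    rw [lintegral_map hg (by fun_prop), Measure.lintegral_compProd (by fun_prop),
      Measure.lintegral_compProd hg, lintegral_map (by fun_prop) hx']
    rfl
  have hcoup : ρ.map (Prod.map x id) ∈ couplings (empiricalMeasure x) ν := by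
    constructor
    · rw [Measure.map_map measurable_fst (by fun_prop)]
      have : Prod.fst ∘ Prod.map x id = x ∘ (Prod.fst : Fin n × F → Fin n) := rfl
      rw [this, ← Measure.map_map hx measurable_fst]
      change Measure.map x (Measure.fst ρ) = _
      rw [Measure.fst_compProd, empiricalMeasure_map _ hx]; rfl
    · rw [← hπ.2, ← hρ, Measure.map_map measurable_snd (by fun_prop),
        Measure.map_map measurable_snd (by fun_prop)]
      rfl
  have hm1 : Measurable fun z : Fin n × F => edist (x z.1) (x' z.1) :=
    (measurable_of_finite (fun i => edist (x i) (x' i))).comp measurable_fst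
  have hm2 : Measurable fun z : Fin n × F => edist (x' z.1) z.2 :=
    (hx'.comp measurable_fst).edist measurable_snd
  calc wasserstein p (empiricalMeasure x) ν
      ≤ (∫⁻ z, edist z.1 z.2 ^ p ∂(ρ.map (Prod.map x id))) ^ (1 / p) := by
        unfold wasserstein
        gcongr
        exact iInf₂_le _ hcoup
    _ = (∫⁻ z, edist (x z.1) z.2 ^ p ∂ρ) ^ (1 / p) := by
        rw [lintegral_map (by fun_prop) (by fun_prop)]; rfl
    _ ≤ (∫⁻ z, ((fun z : Fin n × F => edist (x' z.1) z.2) +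
          fun z : Fin n × F => edist (x z.1) (x' z.1)) z ^ p ∂ρ) ^ (1 / p) := by
        gcongr with z
        rw [Pi.add_apply, add_comm]
        exact edist_triangle _ _ _
    _ ≤ (∫⁻ z, edist (x' z.1) z.2 ^ p ∂ρ) ^ (1 / p) +
          (∫⁻ z, edist (x z.1) (x' z.1) ^ p ∂ρ) ^ (1 / p) :=
        ENNReal.lintegral_Lp_add_le hm2.aemeasurable hm1.aemeasurable hp
    _ = _ := by
        congr 2
        · conv_rhs => rw [← hρ]
          rw [lintegral_map (by fun_prop) (by fun_prop)]; rfl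
        · rw [Measure.lintegral_compProd (by fun_prop)]
          simp only [lintegral_const, measure_univ, mul_one]
          rw [lintegral_empiricalMeasure _ (measurable_of_finite _)]
          rfl

lemma wasserstein_le_of_isProbabilityMeasure {F : Type*} [PseudoEMetricSpace F]
    [MeasurableSpace F] {p : ℝ} (hp : 1 ≤ p) (μ ν : Measure F) [IsProbabilityMeasure μ]
    [IsProbabilityMeasure ν] :
    wasserstein p μ ν ≤ (∫⁻ z, edist z.1 z.2 ^ p ∂μ.prod ν) ^ (1 / p) := by
  unfold wasserstein
  gcongr
  exact iInf₂_le _ ⟨by simp, by simp⟩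

/-! ### Regularity of the projected distances in the sample -/

lemma ae_mem_stiefel {d k : ℕ} (hkd : k ≤ d) : ∀ᵐ E ∂stiefelUniform hkd, E ∈ stiefel d k := by
  have hcont : Continuous fun U : Matrix.orthogonalGroup (Fin d) ℝ =>
      (U : Matrix (Fin d) (Fin d) ℝ).submatrix id (Fin.castLE hkd) :=
    continuous_subtype_val.matrix_submatrix _ _
  have hclosed : IsClosed (stiefel d k) := isClosed_eq (by fun_prop) continuous_const
  rw [stiefelUniform]
  refine (ae_map_iff hcont.aemeasurable hclosed.measurableSet).mpr ?_
  refine Filter.Eventually.of_forall fun U => ?_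
  have hU : (U : Matrix (Fin d) (Fin d) ℝ)ᵀ * U = 1 :=
    (Matrix.mem_orthogonalGroup_iff' (Fin d) ℝ).mp U.2
  refine Matrix.ext fun i j => ?_
  have := congrFun (congrFun hU (Fin.castLE hkd i)) (Fin.castLE hkd j)
  simpa [Matrix.mul_apply, Matrix.one_apply, Fin.ext_iff] using this

lemma stiefelUniform_univ_le {d k : ℕ} (hkd : k ≤ d) :
    stiefelUniform hkd Set.univ ≤ 1 := by
  have hcont : Continuous fun U : Matrix.orthogonalGroup (Fin d) ℝ =>
      (U : Matrix (Fin d) (Fin d) ℝ).submatrix id (Fin.castLE hkd) :=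
    continuous_subtype_val.matrix_submatrix _ _
  rw [stiefelUniform, Measure.map_apply hcont.measurable MeasurableSet.univ, Set.preimage_univ,
    haarOrthogonal]
  exact (Measure.haarMeasure_self (K₀ := ⊤)).le

/-- Minkowski's inequality with a constant, without measurability of the function. -/
lemma lintegral_rpow_add_const_le {α : Type*} [MeasurableSpace α] {m : Measure α}
    (hm : m Set.univ ≤ 1) {p : ℝ} (hp : 1 ≤ p) (g : α → ℝ≥0∞) (c : ℝ≥0∞) :
    (∫⁻ a, (g a + c) ^ p ∂m) ^ (1 / p) ≤ (∫⁻ a, g a ^ p ∂m) ^ (1 / p) + c := by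
  have hp0 : 0 < p := by linarith
  -- The lower integral is attained by a measurable minorant `φ`. Minkowski is applied to `φ ^ (1/p)
  -- - c`, which lies below `g`; thus measurability of the projected distance in `E` is never
  -- needed.
  obtain ⟨φ, hφ, hle, heq⟩ := exists_measurable_le_lintegral_eq m fun a => (g a + c) ^ p
  have hψ : Measurable fun a => φ a ^ (1 / p) - c := (hφ.pow_const _).sub_const _
  rw [heq]
  calc (∫⁻ a, φ a ∂m) ^ (1 / p)
      ≤ (∫⁻ a, ((fun a => φ a ^ (1 / p) - c) + fun _ : α => c : α → ℝ≥0∞) a ^ p ∂m) ^ (1 / p) := by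
        gcongr with a
        rw [← ENNReal.rpow_inv_le_iff hp0, ← one_div]
        exact le_tsub_add
    _ ≤ (∫⁻ a, (φ a ^ (1 / p) - c) ^ p ∂m) ^ (1 / p) + (∫⁻ _, c ^ p ∂m) ^ (1 / p) :=
        ENNReal.lintegral_Lp_add_le hψ.aemeasurable aemeasurable_const hp
    _ ≤ _ := by
        gcongr with a
        · rw [tsub_le_iff_right, one_div, ENNReal.rpow_inv_le_iff hp0]
          exact hle a
        · rw [lintegral_const]
          calc (c ^ p * m Set.univ) ^ (1 / p) ≤ (c ^ p * 1) ^ (1 / p) := by gcongr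
            _ = c := by
              rw [mul_one, ← ENNReal.rpow_mul, mul_one_div_cancel hp0.ne', ENNReal.rpow_one]

lemma prw_le_add {d k : ℕ} {p : ℝ} {μ μ' ν : Measure (EuclideanSpace ℝ (Fin d))} {c : ℝ≥0∞}
    (h : ∀ E ∈ stiefel d k, wasserstein p (μ.map (proj E)) (ν.map (proj E)) ≤
      wasserstein p (μ'.map (proj E)) (ν.map (proj E)) + c) :
    prw p k μ ν ≤ prw p k μ' ν + c :=
  iSup₂_le fun E hE => (h E hE).trans <| by
    gcongr
    exact le_iSup₂ (f := fun E (_ : E ∈ stiefel d k) =>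
      wasserstein p (μ'.map (proj E)) (ν.map (proj E))) E hE

lemma iprw_le_add {d k : ℕ} (hkd : k ≤ d) {p : ℝ} (hp : 1 ≤ p)
    {μ μ' ν : Measure (EuclideanSpace ℝ (Fin d))} {c : ℝ≥0∞}
    (h : ∀ E ∈ stiefel d k, wasserstein p (μ.map (proj E)) (ν.map (proj E)) ≤
      wasserstein p (μ'.map (proj E)) (ν.map (proj E)) + c) :
    iprw p hkd μ ν ≤ iprw p hkd μ' ν + c := by
  refine le_trans ?_ (lintegral_rpow_add_const_le (stiefelUniform_univ_le hkd) hp _ c)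
  unfold iprw
  gcongr ?_ ^ _
  refine lintegral_mono_ae ?_
  filter_upwards [ae_mem_stiefel hkd] with E hE
  gcongr
  exact h E hE

lemma iprw_le_prw {d k : ℕ} (hkd : k ≤ d) {p : ℝ} (hp : 1 ≤ p)
    (μ ν : Measure (EuclideanSpace ℝ (Fin d))) : iprw p hkd μ ν ≤ prw p k μ ν := by
  have hp0 : 0 < p := by linarith
  unfold iprw
  rw [one_div, ENNReal.rpow_inv_le_iff hp0]
  calc _ ≤ ∫⁻ _, prw p k μ ν ^ p ∂stiefelUniform hkd := by
        refine lintegral_mono_ae ?_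
        filter_upwards [ae_mem_stiefel hkd] with E hE
        gcongr
        exact le_iSup₂ (f := fun E (_ : E ∈ stiefel d k) =>
          wasserstein p (μ.map (proj E)) (ν.map (proj E))) E hE
    _ ≤ prw p k μ ν ^ p * 1 := by
        rw [lintegral_const]
        gcongr
        exact stiefelUniform_univ_le hkd
    _ = _ := mul_one _

lemma measurable_proj {d k : ℕ} (E : Matrix (Fin d) (Fin k) ℝ) : Measurable (proj E) :=
  (LinearMap.continuous_of_finiteDimensional (proj E)).measurable

lemma edist_proj_le {d k : ℕ} {E : Matrix (Fin d) (Fin k) ℝ} (hE : E ∈ stiefel d k)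
    (x y : EuclideanSpace ℝ (Fin d)) : edist (proj E x) (proj E y) ≤ ‖x - y‖ₑ := by
  rw [edist_eq_enorm_sub, ← map_sub, ← ofReal_norm, ← ofReal_norm]
  exact ENNReal.ofReal_le_ofReal (norm_proj_le hE _)

lemma sum_rpow_le_rpow_sum {ι : Type*} {p : ℝ} (hp : 1 ≤ p) (s : Finset ι) (a : ι → ℝ≥0∞) :
    ∑ i ∈ s, a i ^ p ≤ (∑ i ∈ s, a i) ^ p := by
  classical
  induction s using Finset.induction_on with
  | empty => simp
  | insert i s hi ih =>
    rw [Finset.sum_insert hi, Finset.sum_insert hi]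
    exact (add_le_add_right ih _).trans (ENNReal.add_rpow_le_rpow_add _ _ hp)

/-- The Lipschitz constant does not depend on `E`, so the bound survives both the supremum and the
integral over frames. -/
lemma wasserstein_proj_empiricalMeasure_le {d k n : ℕ} (hn : 1 ≤ n) {p : ℝ} (hp : 1 ≤ p)
    {E : Matrix (Fin d) (Fin k) ℝ} (hE : E ∈ stiefel d k)
    (x x' : Fin n → EuclideanSpace ℝ (Fin d)) (ν : Measure (EuclideanSpace ℝ (Fin d))) :
    wasserstein p ((empiricalMeasure x).map (proj E)) (ν.map (proj E)) ≤
      wasserstein p ((empiricalMeasure x').map (proj E)) (ν.map (proj E)) +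
      ENNReal.ofReal ((n : ℝ) ^ (-(1 / p)) * ∑ i, ‖x i - x' i‖) := by
  have hp0 : 0 < p := by linarith
  rw [empiricalMeasure_map _ (measurable_proj E), empiricalMeasure_map _ (measurable_proj E)]
  refine (wasserstein_empiricalMeasure_le hp hn _ (fun i => proj E (x' i)) _).trans ?_
  gcongr
  have h1 : ENNReal.ofReal ((n : ℝ) ^ (-(1 / p)) * ∑ i, ‖x i - x' i‖) =
      (n : ℝ≥0∞)⁻¹ ^ (1 / p) * ∑ i, ‖x i - x' i‖ₑ := by
    rw [ENNReal.ofReal_mul (by positivity), ENNReal.ofReal_sum_of_nonneg (by simp),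
      ← ENNReal.ofReal_rpow_of_pos (by positivity), ENNReal.ofReal_natCast, ENNReal.inv_rpow,
      ENNReal.rpow_neg]
    simp
  rw [h1, ENNReal.mul_rpow_of_nonneg _ _ (by positivity)]
  gcongr
  rw [one_div, ENNReal.rpow_inv_le_iff hp0]
  calc ∑ i, edist (proj E (x i)) (proj E (x' i)) ^ p ≤ ∑ i, ‖x i - x' i‖ₑ ^ p := by
        gcongr with i
        exact edist_proj_le hE _ _
    _ ≤ (∑ i, ‖x i - x' i‖ₑ) ^ p :=
        sum_rpow_le_rpow_sum hp _ _

/-- The product coupling has finite cost, uniformly in `E`, because an integer moment of order at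
least `max p 2` is finite. -/
lemma prw_empiricalMeasure_ne_top {d k n : ℕ} (hk1 : 1 ≤ k) (hkd : k ≤ d) (hn : 1 ≤ n) {p : ℝ}
    (hp : 1 ≤ p) {σ V : ℝ} {μ : Measure (EuclideanSpace ℝ (Fin d))} [IsProbabilityMeasure μ]
    (hμ : BernsteinTail k σ V μ) (x : Fin n → EuclideanSpace ℝ (Fin d)) :
    prw p k (empiricalMeasure x) μ ≠ ∞ := by
  have hp0 : 0 < p := by linarith
  have := isProbabilityMeasure_empiricalMeasure hn x
  have hmom : ∀ a : EuclideanSpace ℝ (Fin d), ∫⁻ y, ‖a - y‖ₑ ^ p ∂μ ≠ ∞ := by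
    intro a
    obtain ⟨r, hr⟩ := exists_nat_ge (max p 2)
    have hr2 : 2 ≤ r := by exact_mod_cast (le_max_right p 2).trans hr
    have hmem : MemLp id (r : ℝ≥0∞) μ := by
      refine ⟨aestronglyMeasurable_id, ?_⟩
      rw [eLpNorm_lt_top_iff_lintegral_rpow_enorm_lt_top (by simp; omega) (by simp)]
      simp only [ENNReal.toReal_natCast, ENNReal.rpow_natCast, id]
      exact (hμ.lintegral_enorm_pow_le hk1 hkd hr2).trans_lt ENNReal.ofReal_lt_top
    have hmem' : MemLp (fun y => a - y) (ENNReal.ofReal p) μ := by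
      refine ((memLp_const a).sub hmem).mono_exponent ?_
      rw [← ENNReal.ofReal_natCast]
      exact ENNReal.ofReal_le_ofReal ((le_max_left p 2).trans hr)
    have := hmem'.2
    rw [eLpNorm_lt_top_iff_lintegral_rpow_enorm_lt_top (by simpa using hp0) (by simp),
      ENNReal.toReal_ofReal hp0.le] at this
    exact this.ne
  have hle : prw p k (empiricalMeasure x) μ ≤
      (∫⁻ z, ‖z.1 - z.2‖ₑ ^ p ∂(empiricalMeasure x).prod μ) ^ (1 / p) := by
    refine iSup₂_le fun E hE => ?_
    have := Measure.isProbabilityMeasure_map (μ := empiricalMeasure x)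
      (measurable_proj E).aemeasurable
    have := Measure.isProbabilityMeasure_map (μ := μ) (measurable_proj E).aemeasurable
    refine (wasserstein_le_of_isProbabilityMeasure hp _ _).trans ?_
    gcongr ?_ ^ _
    rw [Measure.map_prod_map _ _ (measurable_proj E) (measurable_proj E)]
    refine (lintegral_map (by fun_prop)
      ((measurable_proj E).prodMap (measurable_proj E))).trans_le ?_
    refine lintegral_mono fun z => ?_
    exact ENNReal.rpow_le_rpow (edist_proj_le hE _ _) hp0.le
  refine ne_top_of_le_ne_top ?_ hle
  refine ENNReal.rpow_ne_top_of_nonneg (by positivity) ?_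
  rw [lintegral_prod _ (by fun_prop), lintegral_empiricalMeasure _ (by fun_prop)]
  refine ENNReal.mul_ne_top (by simp; omega) ?_
  exact (ENNReal.sum_lt_top.mpr fun i _ => (hmom _).lt_top).ne

/-! ### A Bernstein inequality of McDiarmid type -/

/-- The left side is `2 cosh u ≤ 2 cosh v = 2 (exp v - sinh v)`, and `sinh v ≥ v`. The bound has no
linear term in `v`, so no first moment will be needed. -/
lemma exp_add_exp_neg_le (u v : ℝ) (h : |u| ≤ v) :
    Real.exp u + Real.exp (-u) ≤ 2 * (Real.exp v - v) := by
  have h1 : Real.cosh u ≤ Real.cosh v := Real.cosh_le_cosh.mpr (h.trans (le_abs_self v))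
  have h2 : v ≤ Real.sinh v := Real.self_le_sinh_iff.mpr ((abs_nonneg u).trans h)
  have h3 := Real.cosh_add_sinh v
  have h4 := Real.cosh_eq u
  linarith

lemma ofReal_exp_sub_self_eq_tsum {v : ℝ} (hv : 0 ≤ v) :
    ENNReal.ofReal (Real.exp v - v) =
      1 + ∑' r : ℕ, ENNReal.ofReal (v ^ (r + 2) / (r + 2).factorial) := by
  have hs : HasSum (fun r : ℕ => v ^ r / r.factorial) (Real.exp v) := by
    have := NormedSpace.expSeries_div_hasSum_exp (𝔸 := ℝ) v
    rwa [← Real.exp_eq_exp_ℝ] at this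
  have hs2 := (hasSum_nat_add_iff' 2).mpr hs
  rw [← ENNReal.ofReal_tsum_of_nonneg (fun r => by positivity) hs2.summable, hs2.tsum_eq,
    ← ENNReal.ofReal_one, ← ENNReal.ofReal_add zero_le_one]
  · simp only [Finset.sum_range_succ, Finset.sum_range_zero]
    congr 1
    simp
    ring
  · rw [← hs2.tsum_eq]
    exact tsum_nonneg fun r => by positivity

/-- Integrated term by term, the exponential series is dominated by a geometric series of ratio `l *
M`, because the factorials cancel; `1 + x ≤ exp x` concludes. -/
lemma lintegral_ofReal_exp_sub_self_le {α : Type*} [MeasurableSpace α] {m : Measure α}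
    [IsProbabilityMeasure m] {D : α → ℝ} (hD : Measurable D) (hD0 : ∀ a, 0 ≤ D a)
    {s M : ℝ} (hM : 0 ≤ M)
    (hmom : ∀ r : ℕ, ∫⁻ a, ENNReal.ofReal (D a ^ (r + 2)) ∂m ≤
      ENNReal.ofReal (1 / 2 * s ^ 2 * ((r + 2).factorial : ℝ) * M ^ r))
    {l : ℝ} (hl : 0 ≤ l) (hlM : l * M < 1) :
    ∫⁻ a, ENNReal.ofReal (Real.exp (l * D a) - l * D a) ∂m ≤
      ENNReal.ofReal (Real.exp (l ^ 2 * s ^ 2 / (2 * (1 - l * M)))) := by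
  have hgeo := hasSum_geometric_of_lt_one (mul_nonneg hl hM) hlM
  have hgeo2 := hgeo.mul_left (l ^ 2 * s ^ 2 / 2)
  calc ∫⁻ a, ENNReal.ofReal (Real.exp (l * D a) - l * D a) ∂m
      = ∫⁻ a, (1 + ∑' r : ℕ, ENNReal.ofReal ((l * D a) ^ (r + 2) / (r + 2).factorial)) ∂m := by
        refine lintegral_congr fun a => ?_
        exact ofReal_exp_sub_self_eq_tsum (mul_nonneg hl (hD0 a))
    _ = 1 + ∑' r : ℕ, ∫⁻ a, ENNReal.ofReal ((l * D a) ^ (r + 2) / (r + 2).factorial) ∂m := by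
        rw [lintegral_add_left measurable_const, lintegral_tsum fun r => by fun_prop]
        simp
    _ ≤ 1 + ∑' r : ℕ, ENNReal.ofReal (l ^ 2 * s ^ 2 / 2 * (l * M) ^ r) := by
        gcongr with r
        have h1 : ∀ a, ENNReal.ofReal ((l * D a) ^ (r + 2) / (r + 2).factorial) =
            ENNReal.ofReal (l ^ (r + 2) / (r + 2).factorial) * ENNReal.ofReal (D a ^ (r + 2)) := by
          intro a
          rw [← ENNReal.ofReal_mul (by positivity)]
          congr 1
          ring
        simp_rw [h1]
        rw [lintegral_const_mul _ (by fun_prop)]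
        refine (mul_le_mul_right (hmom r) _).trans ?_
        rw [← ENNReal.ofReal_mul (by positivity)]
        refine ENNReal.ofReal_le_ofReal (le_of_eq ?_)
        have : ((r + 2).factorial : ℝ) ≠ 0 := by positivity
        field_simp
        ring
    _ = ENNReal.ofReal (1 + l ^ 2 * s ^ 2 / 2 * (1 - l * M)⁻¹) := by
        rw [← ENNReal.ofReal_tsum_of_nonneg (fun r => by positivity) hgeo2.summable, hgeo2.tsum_eq,
          ENNReal.ofReal_add zero_le_one, ENNReal.ofReal_one]
        have := sub_pos.mpr hlM
        positivity
    _ ≤ _ := by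
        refine ENNReal.ofReal_le_ofReal ?_
        have h := Real.add_one_le_exp (l ^ 2 * s ^ 2 / (2 * (1 - l * M)))
        have h2 : l ^ 2 * s ^ 2 / 2 * (1 - l * M)⁻¹ = l ^ 2 * s ^ 2 / (2 * (1 - l * M)) := by
          have := (sub_pos.mpr hlM).ne'
          field_simp
        linarith

lemma ofReal_exp_integral_le {α : Type*} [MeasurableSpace α] {m : Measure α}
    [IsProbabilityMeasure m] {g : α → ℝ} (hg : Integrable g m) :
    ENNReal.ofReal (Real.exp (∫ a, g a ∂m)) ≤ ∫⁻ a, ENNReal.ofReal (Real.exp (g a)) ∂m := by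
  by_cases h : Integrable (fun a => Real.exp (g a)) m
  · rw [← ofReal_integral_eq_lintegral_ofReal h (ae_of_all _ fun a => (Real.exp_pos _).le)]
    refine ENNReal.ofReal_le_ofReal ?_
    exact convexOn_exp.map_integral_le Real.continuous_exp.continuousOn isClosed_univ
      (ae_of_all _ fun _ => Set.mem_univ _) hg h
  · have : ∫⁻ a, ENNReal.ofReal (Real.exp (g a)) ∂m = ∞ := by
      by_contra hne
      refine h ⟨(Real.continuous_exp.comp_aestronglyMeasurable hg.1), ?_⟩
      rw [hasFiniteIntegral_iff_ofReal (ae_of_all _ fun a => (Real.exp_pos _).le)]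
      exact lt_top_iff_ne_top.mpr hne
    rw [this]
    exact le_top

lemma lintegral_exp_sub_integral_le {α : Type*} [MeasurableSpace α] {m : Measure α}
    [IsProbabilityMeasure m] {g : α → ℝ} (hgm : Measurable g) (hg : Integrable g m)
    {D : α × α → ℝ} (hD : Measurable D) (hgD : ∀ a b, |g a - g b| ≤ D (a, b))
    {s M : ℝ} (hM : 0 ≤ M)
    (hmom : ∀ r : ℕ, ∫⁻ z, ENNReal.ofReal (D z ^ (r + 2)) ∂(m.prod m) ≤
      ENNReal.ofReal (1 / 2 * s ^ 2 * ((r + 2).factorial : ℝ) * M ^ r))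
    {l : ℝ} (hl : 0 ≤ l) (hlM : l * M < 1) :
    ∫⁻ a, ENNReal.ofReal (Real.exp (l * (g a - ∫ b, g b ∂m))) ∂m ≤
      ENNReal.ofReal (Real.exp (l ^ 2 * s ^ 2 / (2 * (1 - l * M)))) := by
  refine le_trans ?_ (lintegral_ofReal_exp_sub_self_le hD
    (fun z => (abs_nonneg _).trans (hgD z.1 z.2)) hM hmom hl hlM)
  have hmeas : Measurable fun z : α × α => ENNReal.ofReal (Real.exp (l * (g z.1 - g z.2))) := by
    fun_prop
  have h1 : ∫⁻ a, ENNReal.ofReal (Real.exp (l * (g a - ∫ b, g b ∂m))) ∂m ≤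
      ∫⁻ z, ENNReal.ofReal (Real.exp (l * (g z.1 - g z.2))) ∂(m.prod m) := by
    rw [lintegral_prod _ hmeas.aemeasurable]
    refine lintegral_mono fun a => ?_
    have hint : Integrable (fun b => l * (g a - g b)) m :=
      ((integrable_const (g a)).sub hg).const_mul l
    refine le_trans (le_of_eq ?_) (ofReal_exp_integral_le hint)
    have : ∫ b, l * (g a - g b) ∂m = l * (g a - ∫ b, g b ∂m) := by
      rw [integral_const_mul, integral_sub (integrable_const _) hg]
      simp
    rw [← this]
  -- Exchanging the two independent copies flips the sign; averaging both forms yields the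
  -- hyperbolic cosine.
  have h2 : ∫⁻ z, ENNReal.ofReal (Real.exp (l * (g z.1 - g z.2))) ∂(m.prod m) =
      ∫⁻ z, ENNReal.ofReal (Real.exp (-(l * (g z.1 - g z.2)))) ∂(m.prod m) := by
    conv_lhs => rw [← Measure.prod_swap]
    rw [lintegral_map hmeas measurable_swap]
    refine lintegral_congr fun z => ?_
    congr 2
    simp only [Prod.fst_swap, Prod.snd_swap]
    ring
  refine h1.trans ?_
  have h3 : 2 * ∫⁻ z, ENNReal.ofReal (Real.exp (l * (g z.1 - g z.2))) ∂(m.prod m) ≤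
      2 * ∫⁻ z, ENNReal.ofReal (Real.exp (l * D z) - l * D z) ∂(m.prod m) := by
    conv_lhs => rw [two_mul]; arg 2; rw [h2]
    rw [← lintegral_add_left hmeas, ← lintegral_const_mul _ (by fun_prop)]
    refine lintegral_mono fun z => ?_
    simp only
    rw [← ENNReal.ofReal_add (Real.exp_pos _).le (Real.exp_pos _).le,
      show (2 : ℝ≥0∞) = ENNReal.ofReal 2 by simp, ← ENNReal.ofReal_mul zero_le_two]
    refine ENNReal.ofReal_le_ofReal (exp_add_exp_neg_le _ _ ?_)
    rw [abs_mul, abs_of_nonneg hl]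
    exact mul_le_mul_of_nonneg_left (hgD _ _) hl
  exact (ENNReal.mul_le_mul_iff_right two_ne_zero ENNReal.ofNat_ne_top).mp h3

/-- This is the source of measurability for the distance as a function of the sample. -/
lemma continuous_of_abs_sub_le_sum {F : Type*} [NormedAddCommGroup F] {n : ℕ} {f : (Fin n → F) → ℝ} {c : ℝ}
    (hf : ∀ x y, |f x - f y| ≤ c * ∑ i, ‖x i - y i‖) : Continuous f := by
  rw [continuous_iff_continuousAt]
  intro y
  rw [ContinuousAt, tendsto_iff_norm_sub_tendsto_zero]
  refine squeeze_zero (fun _ => norm_nonneg _) (fun x => hf x y) ?_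
  have : Continuous fun x : Fin n → F => c * ∑ i, ‖x i - y i‖ := by fun_prop
  simpa using this.tendsto y

/-! ### Exponential moments and tails under a product measure. -/

section Product

variable {F : Type*} [NormedAddCommGroup F] [MeasurableSpace F] [BorelSpace F]
  [SecondCountableTopology F]

/-- Convexity gives `(a + b) ^ (r + 2) ≤ 2 ^ (r + 1) (a ^ (r + 2) + b ^ (r + 2))`; two equal moments
make the factor `2 ^ (r + 2)`, absorbed by doubling both `σ` and `V`. -/
lemma lintegral_mul_norm_sub_pow_le {μ : Measure F} [IsProbabilityMeasure μ] {σ V : ℝ}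
    (hmom : ∀ r : ℕ, ∫⁻ x, ‖x‖ₑ ^ (r + 2) ∂μ ≤
      ENNReal.ofReal (1 / 2 * σ ^ 2 * ((r + 2).factorial : ℝ) * V ^ r))
    {c : ℝ} (hc : 0 ≤ c) (r : ℕ) :
    ∫⁻ z : F × F, ENNReal.ofReal ((c * ‖z.1 - z.2‖) ^ (r + 2)) ∂(μ.prod μ) ≤
      ENNReal.ofReal
        (1 / 2 * (2 * c * σ) ^ 2 * ((r + 2).factorial : ℝ) * (2 * c * V) ^ r) := by
  have hpt : ∀ z : F × F, ENNReal.ofReal ((c * ‖z.1 - z.2‖) ^ (r + 2)) ≤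
      ENNReal.ofReal (c ^ (r + 2) * 2 ^ (r + 1)) * (‖z.1‖ₑ ^ (r + 2) + ‖z.2‖ₑ ^ (r + 2)) := by
    intro z
    rw [← ofReal_norm, ← ofReal_norm, ← ENNReal.ofReal_pow (norm_nonneg _),
      ← ENNReal.ofReal_pow (norm_nonneg _), ← ENNReal.ofReal_add (by positivity) (by positivity),
      ← ENNReal.ofReal_mul (by positivity)]
    refine ENNReal.ofReal_le_ofReal ?_
    rw [mul_pow, mul_assoc]
    gcongr
    calc ‖z.1 - z.2‖ ^ (r + 2) ≤ (‖z.1‖ + ‖z.2‖) ^ (r + 2) := by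
          gcongr
          exact norm_sub_le _ _
      _ ≤ _ := add_pow_le (norm_nonneg _) (norm_nonneg _) _
  refine (lintegral_mono hpt).trans ?_
  rw [lintegral_const_mul _ (by fun_prop), lintegral_add_left (by fun_prop)]
  have e1 : ∫⁻ z : F × F, ‖z.1‖ₑ ^ (r + 2) ∂(μ.prod μ) = ∫⁻ x, ‖x‖ₑ ^ (r + 2) ∂μ :=
    (measurePreserving_fst (μ := μ) (ν := μ)).lintegral_comp (f := fun x : F => ‖x‖ₑ ^ (r + 2))
      (by fun_prop)
  have e2 : ∫⁻ z : F × F, ‖z.2‖ₑ ^ (r + 2) ∂(μ.prod μ) = ∫⁻ x, ‖x‖ₑ ^ (r + 2) ∂μ :=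
    (measurePreserving_snd (μ := μ) (ν := μ)).lintegral_comp (f := fun x : F => ‖x‖ₑ ^ (r + 2))
      (by fun_prop)
  rw [e1, e2, ← two_mul]
  calc _ ≤ ENNReal.ofReal (c ^ (r + 2) * 2 ^ (r + 1)) *
        (2 * ENNReal.ofReal (1 / 2 * σ ^ 2 * ((r + 2).factorial : ℝ) * V ^ r)) := by
        gcongr
        exact hmom r
    _ = _ := by
        rw [show (2 : ℝ≥0∞) = ENNReal.ofReal 2 by simp, ← ENNReal.ofReal_mul zero_le_two,
          ← ENNReal.ofReal_mul (by positivity)]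
        congr 1
        ring

lemma integrable_of_abs_sub_le_sum {μ : Measure F} [IsProbabilityMeasure μ]
    (hμ : Integrable id μ) {n : ℕ} {f : (Fin n → F) → ℝ} {c : ℝ}
    (hf : ∀ x y, |f x - f y| ≤ c * ∑ i, ‖x i - y i‖) :
    Integrable f (Measure.pi fun _ => μ) := by
  have hi : Integrable (fun x : Fin n → F => |f 0| + c * ∑ i, ‖x i‖) (Measure.pi fun _ => μ) := by
    refine (integrable_const _).add (Integrable.const_mul (integrable_finsetSum _ fun i _ => ?_) c)
    exact ((measurePreserving_eval (fun _ => μ) i).integrable_comp_of_integrable hμ).norm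
  refine hi.mono' (continuous_of_abs_sub_le_sum hf).aestronglyMeasurable (ae_of_all _ fun x => ?_)
  have h := hf x 0
  simp only [Pi.zero_apply, sub_zero] at h
  have h2 := abs_sub_abs_le_abs_sub (f x) (f 0)
  rw [Real.norm_eq_abs]
  linarith

lemma lintegral_pi_exp_sub_integral_le {μ : Measure F} [IsProbabilityMeasure μ] {σ V : ℝ}
    (hV : 0 ≤ V) (hμ : Integrable id μ)
    (hmom : ∀ r : ℕ, ∫⁻ x, ‖x‖ₑ ^ (r + 2) ∂μ ≤
      ENNReal.ofReal (1 / 2 * σ ^ 2 * ((r + 2).factorial : ℝ) * V ^ r))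
    {c l : ℝ} (hc : 0 ≤ c) (hl : 0 ≤ l) (hlM : l * (2 * c * V) < 1)
    {n : ℕ} (f : (Fin n → F) → ℝ) (hf : ∀ x y, |f x - f y| ≤ c * ∑ i, ‖x i - y i‖) :
    ∫⁻ x, ENNReal.ofReal (Real.exp (l * (f x - ∫ y, f y ∂(Measure.pi fun _ => μ))))
        ∂(Measure.pi fun _ => μ) ≤
      ENNReal.ofReal (Real.exp (n * (l ^ 2 * (2 * c * σ) ^ 2 / (2 * (1 - l * (2 * c * V)))))) := by
  induction n with
  | zero =>
    have h0 : ∀ x, f x = f 0 := fun x => congrArg f (Subsingleton.elim x 0)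
    simp [h0]
  | succ n ih =>
    set B := l ^ 2 * (2 * c * σ) ^ 2 / (2 * (1 - l * (2 * c * V))) with hB
    have hmp := measurePreserving_piFinSuccAbove (fun _ : Fin (n + 1) => μ) 0
    have hmps := hmp.symm
    let ν : Measure (Fin n → F) := Measure.pi fun _ => μ
    let h : F × (Fin n → F) → ℝ := fun z => f (Fin.cons z.1 z.2)
    have hfm : Measurable f := (continuous_of_abs_sub_le_sum hf).measurable
    have hfi := integrable_of_abs_sub_le_sum hμ hf
    have hcons : ∀ z : F × (Fin n → F),
        (MeasurableEquiv.piFinSuccAbove (fun _ : Fin (n + 1) => F) 0).symm z =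
          (Fin.cons z.1 z.2 : Fin (n + 1) → F) := by
      intro z
      simp [MeasurableEquiv.piFinSuccAbove, Fin.insertNthEquiv]
    have hh : h = f ∘ (MeasurableEquiv.piFinSuccAbove (fun _ : Fin (n + 1) => F) 0).symm := by
      ext z; exact congrArg f (hcons z).symm
    have hhm : Measurable h := by rw [hh]; exact hfm.comp (MeasurableEquiv.measurable _)
    have hhi : Integrable h (μ.prod ν) := by
      rw [hh]; exact hmps.integrable_comp_of_integrable hfi
    have hint : ∫ y, f y ∂(Measure.pi fun _ : Fin (n + 1) => μ) = ∫ z, h z ∂(μ.prod ν) := by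
      rw [hh]
      exact (hmps.integral_comp (MeasurableEquiv.measurableEmbedding _) f).symm
    have hlint : ∀ a : ℝ, ∫⁻ x, ENNReal.ofReal (Real.exp (l * (f x - a)))
          ∂(Measure.pi fun _ : Fin (n + 1) => μ) =
        ∫⁻ z, ENNReal.ofReal (Real.exp (l * (h z - a))) ∂(μ.prod ν) := by
      intro a
      rw [hh]
      exact (hmps.lintegral_comp (f := fun x => ENNReal.ofReal (Real.exp (l * (f x - a))))
        (by fun_prop)).symm
    have hx : ∀ y, ∀ a b, |h (a, y) - h (b, y)| ≤ c * ‖a - b‖ := by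
      intro y a b
      simpa [h, Fin.sum_univ_succ] using hf (Fin.cons a y) (Fin.cons b y)
    have hy : ∀ a, ∀ y y', |h (a, y) - h (a, y')| ≤ c * ∑ i, ‖y i - y' i‖ := by
      intro a y y'
      simpa [h, Fin.sum_univ_succ] using hf (Fin.cons a y) (Fin.cons a y')
    have hyi : ∀ y, Integrable (fun a => h (a, y)) μ := by
      intro y
      have hi : Integrable (fun a : F => |h (0, y)| + c * ‖a‖) μ :=
        (integrable_const _).add (hμ.norm.const_mul c)
      refine hi.mono' (hhm.comp measurable_prodMk_right).aestronglyMeasurable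
        (ae_of_all _ fun a => ?_)
      have h1 := hx y a 0
      have h2 := abs_sub_abs_le_abs_sub (h (a, y)) (h (0, y))
      rw [sub_zero] at h1
      rw [Real.norm_eq_abs]
      linarith
    -- Averaging over the first coordinate keeps the Lipschitz constant `c`, so the induction
    -- hypothesis applies to `g`; the fluctuation of `h` around `g` is the one-variable bound.
    let g : (Fin n → F) → ℝ := fun y => ∫ a, h (a, y) ∂μ
    have hg : ∀ y y', |g y - g y'| ≤ c * ∑ i, ‖y i - y' i‖ := by
      intro y y'
      rw [← integral_sub (hyi y) (hyi y')]
      refine (abs_integral_le_integral_abs).trans ?_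
      calc _ ≤ ∫ _, c * ∑ i, ‖y i - y' i‖ ∂μ :=
            integral_mono ((hyi y).sub (hyi y')).abs (integrable_const _) fun a => hy a y y'
        _ = _ := by simp
    have hgm : Measurable g := (continuous_of_abs_sub_le_sum hg).measurable
    have hgint : ∫ z, h z ∂(μ.prod ν) = ∫ y, g y ∂ν := integral_prod_symm _ hhi
    rw [hint, hlint, hgint, lintegral_prod_symm _ (by fun_prop)]
    have hstep : ∀ y, ∫⁻ a, ENNReal.ofReal (Real.exp (l * (h (a, y) - g y))) ∂μ ≤
        ENNReal.ofReal (Real.exp B) := fun y =>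
      lintegral_exp_sub_integral_le (by fun_prop) (hyi y)
        (D := fun z => c * ‖z.1 - z.2‖) (by fun_prop) (hx y) (by positivity)
        (lintegral_mul_norm_sub_pow_le hmom hc) hl hlM
    calc ∫⁻ y, ∫⁻ a, ENNReal.ofReal (Real.exp (l * (h (a, y) - ∫ y, g y ∂ν))) ∂μ ∂ν
        = ∫⁻ y, ENNReal.ofReal (Real.exp (l * (g y - ∫ y, g y ∂ν))) *
            ∫⁻ a, ENNReal.ofReal (Real.exp (l * (h (a, y) - g y))) ∂μ ∂ν := by
          refine lintegral_congr fun y => ?_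
          rw [← lintegral_const_mul _ (by fun_prop)]
          refine lintegral_congr fun a => ?_
          rw [← ENNReal.ofReal_mul (Real.exp_pos _).le, ← Real.exp_add]
          congr 2
          ring
      _ ≤ ∫⁻ y, ENNReal.ofReal (Real.exp (l * (g y - ∫ y, g y ∂ν))) *
            ENNReal.ofReal (Real.exp B) ∂ν := by
          gcongr with y
          exact hstep y
      _ = (∫⁻ y, ENNReal.ofReal (Real.exp (l * (g y - ∫ y, g y ∂ν))) ∂ν) *
            ENNReal.ofReal (Real.exp B) := lintegral_mul_const _ (by fun_prop)
      _ ≤ ENNReal.ofReal (Real.exp (n * B)) * ENNReal.ofReal (Real.exp B) := by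
          gcongr
          exact ih g hg
      _ = _ := by
          rw [← ENNReal.ofReal_mul (Real.exp_pos _).le, ← Real.exp_add]
          congr 2
          push_cast
          ring

lemma measureReal_pi_sub_integral_ge_le {μ : Measure F} [IsProbabilityMeasure μ] {σ V : ℝ}
    (hσ : 0 < σ) (hV : 0 < V) (hμ : Integrable id μ)
    (hmom : ∀ r : ℕ, ∫⁻ x, ‖x‖ₑ ^ (r + 2) ∂μ ≤
      ENNReal.ofReal (1 / 2 * σ ^ 2 * ((r + 2).factorial : ℝ) * V ^ r))
    {c : ℝ} (hc : 0 < c) {n : ℕ} (hn : 1 ≤ n)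
    (f : (Fin n → F) → ℝ) (hf : ∀ x y, |f x - f y| ≤ c * ∑ i, ‖x i - y i‖)
    {t : ℝ} (ht : 0 ≤ t) :
    (Measure.pi fun _ : Fin n => μ).real
        {x | t ≤ f x - ∫ y, f y ∂(Measure.pi fun _ => μ)} ≤
      Real.exp (-(t ^ 2 / (2 * (n * (2 * c * σ) ^ 2 + t * (2 * c * V))))) := by
  set s := 2 * c * σ with hs
  set M := 2 * c * V with hM
  have hn0 : (0 : ℝ) < n := by exact_mod_cast hn
  have hs0 : 0 < s := by positivity
  have hM0 : 0 < M := by positivity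
  set B := n * s ^ 2 + t * M with hB
  have hB0 : 0 < B := by positivity
  -- This choice makes `1 - l * M = n s² / B`, so the exponent `n l² s² / (2 (1 - l M)) - l t`
  -- collapses to `-t² / (2B)`.
  set l := t / B with hl
  have hl0 : 0 ≤ l := by positivity
  have h1l : 1 - l * M = n * s ^ 2 / B := by
    rw [hl]; field_simp; rw [hB]; ring
  have hlM : l * M < 1 := by
    have : 0 < n * s ^ 2 / B := by positivity
    linarith
  set ν : Measure (Fin n → F) := Measure.pi fun _ => μ
  set a := ∫ y, f y ∂ν
  have hfm : Measurable f := (continuous_of_abs_sub_le_sum hf).measurable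
  have hmgf := lintegral_pi_exp_sub_integral_le hV.le hμ hmom hc.le hl0 hlM f hf
  have hmarkov := meas_ge_le_lintegral_div (μ := ν)
    (f := fun x => ENNReal.ofReal (Real.exp (l * (f x - a)))) (by fun_prop)
    (ε := ENNReal.ofReal (Real.exp (l * t))) (by simp [Real.exp_pos]) (by simp)
  refine ENNReal.toReal_le_of_le_ofReal (Real.exp_pos _).le ?_
  calc ν {x | t ≤ f x - a}
      ≤ ν {x | ENNReal.ofReal (Real.exp (l * t)) ≤ ENNReal.ofReal (Real.exp (l * (f x - a)))} := by
        refine measure_mono fun x hx => ?_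
        refine ENNReal.ofReal_le_ofReal (Real.exp_le_exp.mpr ?_)
        exact mul_le_mul_of_nonneg_left hx hl0
    _ ≤ _ := hmarkov
    _ ≤ ENNReal.ofReal (Real.exp (n * (l ^ 2 * s ^ 2 / (2 * (1 - l * M))))) /
          ENNReal.ofReal (Real.exp (l * t)) := by gcongr
    _ = _ := by
        rw [← ENNReal.ofReal_div_of_pos (Real.exp_pos _), ← Real.exp_sub, h1l]
        congr 2
        rw [hl]
        field_simp
        ring

lemma measureReal_pi_abs_sub_integral_ge_le {μ : Measure F} [IsProbabilityMeasure μ] {σ V : ℝ}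
    (hσ : 0 < σ) (hV : 0 < V) (hμ : Integrable id μ)
    (hmom : ∀ r : ℕ, ∫⁻ x, ‖x‖ₑ ^ (r + 2) ∂μ ≤
      ENNReal.ofReal (1 / 2 * σ ^ 2 * ((r + 2).factorial : ℝ) * V ^ r))
    {c : ℝ} (hc : 0 < c) {n : ℕ} (hn : 1 ≤ n)
    (f : (Fin n → F) → ℝ) (hf : ∀ x y, |f x - f y| ≤ c * ∑ i, ‖x i - y i‖)
    {t : ℝ} (ht : 0 ≤ t) :
    (Measure.pi fun _ : Fin n => μ).real
        {x | t ≤ |f x - ∫ y, f y ∂(Measure.pi fun _ => μ)|} ≤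
      2 * Real.exp (-(t ^ 2 / (2 * (n * (2 * c * σ) ^ 2 + t * (2 * c * V))))) := by
  have h1 := measureReal_pi_sub_integral_ge_le hσ hV hμ hmom hc hn f hf ht
  have h2 := measureReal_pi_sub_integral_ge_le hσ hV hμ hmom hc hn (fun x => -f x)
    (fun x y => by rw [← abs_neg]; convert hf x y using 2; ring) ht
  rw [integral_neg] at h2
  set a := ∫ y, f y ∂(Measure.pi fun _ : Fin n => μ)
  have hsub : {x | t ≤ |f x - a|} ⊆ {x | t ≤ f x - a} ∪ {x | t ≤ -f x - -a} := by
    intro x hx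
    rcases le_abs.mp (show t ≤ |f x - a| from hx) with h | h
    · exact Or.inl h
    · exact Or.inr (show t ≤ -f x - -a by linarith)
  have h3 := (measureReal_mono (μ := Measure.pi fun _ : Fin n => μ) hsub).trans
    (measureReal_union_le _ _)
  linarith

end Product

/-! ### Transfer to the random sample and conclusion. -/

lemma BernsteinTail.integrable_id {d k : ℕ} (hk1 : 1 ≤ k) (hkd : k ≤ d) {σ V : ℝ}
    {μ : Measure (EuclideanSpace ℝ (Fin d))} [IsProbabilityMeasure μ]
    (h : BernsteinTail k σ V μ) : Integrable id μ := by
  have hmem : MemLp id 2 μ := by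
    refine ⟨aestronglyMeasurable_id, ?_⟩
    rw [eLpNorm_lt_top_iff_lintegral_rpow_enorm_lt_top (by simp) (by simp)]
    have := (h.lintegral_enorm_pow_le hk1 hkd le_rfl).trans_lt ENNReal.ofReal_lt_top
    simpa using this
  exact hmem.integrable (by norm_num)

/-- The concentration inequality for a functional of the sample that is finite and Lipschitz
for the `ℓ¹` distance of samples. -/
lemma concentration_of_le_add {d k n : ℕ} (hk1 : 1 ≤ k) (hkd : k ≤ d) (hn : 1 ≤ n)
    {c : ℝ} (hc : 0 < c)
    (μ : Measure (EuclideanSpace ℝ (Fin d))) [IsProbabilityMeasure μ]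
    {σ V : ℝ} (hμ : BernsteinTail k σ V μ)
    {Ω : Type*} [MeasurableSpace Ω] (P : Measure Ω) [IsProbabilityMeasure P]
    (X : Fin n → Ω → EuclideanSpace ℝ (Fin d))
    (hX : ∀ i, HasLaw (X i) μ P) (hindep : iIndepFun X P)
    (w : (Fin n → EuclideanSpace ℝ (Fin d)) → ℝ≥0∞) (hw : ∀ x, w x ≠ ∞)
    (hw' : ∀ x y, w x ≤ w y + ENNReal.ofReal (c * ∑ i, ‖x i - y i‖)) :
    Integrable (fun ω => (w fun i => X i ω).toReal) P ∧
    ∀ t : ℝ, 0 ≤ t →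
      P.real {ω | t ≤ |(w fun i => X i ω).toReal - ∫ ω', (w fun i => X i ω').toReal ∂P|} ≤
        2 * Real.exp (-(t ^ 2 / (2 * (n * (2 * c * σ) ^ 2 + t * (2 * c * V))))) := by
  let f : (Fin n → EuclideanSpace ℝ (Fin d)) → ℝ := fun x => (w x).toReal
  have hsub : ∀ x y, f x - f y ≤ c * ∑ i, ‖x i - y i‖ := by
    intro x y
    have h0 : 0 ≤ c * ∑ i, ‖x i - y i‖ := by positivity
    have := ENNReal.toReal_mono (ENNReal.add_ne_top.mpr ⟨hw y, ENNReal.ofReal_ne_top⟩) (hw' x y)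
    rw [ENNReal.toReal_add (hw y) ENNReal.ofReal_ne_top, ENNReal.toReal_ofReal h0] at this
    simp only [f]
    linarith
  have hf : ∀ x y, |f x - f y| ≤ c * ∑ i, ‖x i - y i‖ := by
    intro x y
    refine abs_sub_le_iff.mpr ⟨hsub x y, ?_⟩
    simpa only [norm_sub_rev] using hsub y x
  have hint := hμ.integrable_id hk1 hkd
  have hXm : ∀ i, AEMeasurable (X i) P := fun i => (hX i).aemeasurable
  have hXm' : AEMeasurable (fun ω i => X i ω) P := aemeasurable_pi_lambda _ hXm
  have hlaw : P.map (fun ω i => X i ω) = Measure.pi fun _ => μ := by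
    rw [(iIndepFun_iff_map_fun_eq_pi_map hXm).mp hindep]
    simp only [(hX _).map_eq]
  have hfm : Measurable f := (continuous_of_abs_sub_le_sum hf).measurable
  have hfi := integrable_of_abs_sub_le_sum hint hf
  have hE : ∫ ω, f (fun i => X i ω) ∂P = ∫ x, f x ∂(Measure.pi fun _ => μ) := by
    rw [← hlaw, integral_map hXm' hfm.aestronglyMeasurable]
  refine ⟨?_, fun t ht => ?_⟩
  · rw [← hlaw] at hfi
    exact hfi.comp_aemeasurable hXm'
  · have h := measureReal_pi_abs_sub_integral_ge_le hμ.1 hμ.2.1 hint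
      (fun r => hμ.lintegral_enorm_pow_le hk1 hkd (Nat.le_add_left 2 r)) hc hn f hf ht
    rw [← hE, ← hlaw, map_measureReal_apply_of_aemeasurable hXm'
      (measurableSet_le measurable_const (by fun_prop))] at h
    exact h

end ProjOT

theorem mainTheorem5 {d k n : ℕ} (hk1 : 1 ≤ k) (hkd : k ≤ d) (hn : 1 ≤ n)
    {p : ℝ} (hp : 1 ≤ p)
    (μ : Measure (EuclideanSpace ℝ (Fin d))) [IsProbabilityMeasure μ]
    {σ V : ℝ} (hμ : ProjOT.BernsteinTail k σ V μ)
    {Ω : Type*} [MeasurableSpace Ω] (P : Measure Ω) [IsProbabilityMeasure P]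
    (X : Fin n → Ω → EuclideanSpace ℝ (Fin d))
    (hX : ∀ i, HasLaw (X i) μ P) (hindep : iIndepFun X P)
    (W : Measure (EuclideanSpace ℝ (Fin d)) → Measure (EuclideanSpace ℝ (Fin d)) → ℝ≥0∞)
    (hW : W = ProjOT.iprw p hkd ∨ W = ProjOT.prw p k) :
    (∀ ω, W (ProjOT.empiricalMeasure fun i => X i ω) μ ≠ ∞) ∧
    Integrable (fun ω => (W (ProjOT.empiricalMeasure fun i => X i ω) μ).toReal) P ∧
    ∀ t : ℝ, 0 ≤ t →
      P.real {ω | t ≤ |(W (ProjOT.empiricalMeasure fun i => X i ω) μ).toReal -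
          ∫ ω', (W (ProjOT.empiricalMeasure fun i => X i ω') μ).toReal ∂P|} ≤
        2 * Real.exp (-(t ^ 2 / (8 * σ ^ 2 * (n : ℝ) ^ (1 - 2 / p) +
          4 * t * V * (n : ℝ) ^ (-(1 / p))))) := by
  have hn0 : (0 : ℝ) < n := by exact_mod_cast hn
  have hfin : ∀ x : Fin n → EuclideanSpace ℝ (Fin d), W (ProjOT.empiricalMeasure x) μ ≠ ∞ := by
    intro x
    have h := ProjOT.prw_empiricalMeasure_ne_top hk1 hkd hn hp hμ x
    rcases hW with rfl | rfl
    · exact ne_top_of_le_ne_top h (ProjOT.iprw_le_prw hkd hp _ _)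
    · exact h
  have hlip : ∀ x y : Fin n → EuclideanSpace ℝ (Fin d), W (ProjOT.empiricalMeasure x) μ ≤
      W (ProjOT.empiricalMeasure y) μ +
        ENNReal.ofReal ((n : ℝ) ^ (-(1 / p)) * ∑ i, ‖x i - y i‖) := by
    intro x y
    have h := fun (E : Matrix (Fin d) (Fin k) ℝ) (hE : E ∈ ProjOT.stiefel d k) =>
      ProjOT.wasserstein_proj_empiricalMeasure_le hn hp hE x y μ
    rcases hW with rfl | rfl
    · exact ProjOT.iprw_le_add hkd hp h
    · exact ProjOT.prw_le_add h
  obtain ⟨h1, h2⟩ := ProjOT.concentration_of_le_add hk1 hkd hn (Real.rpow_pos_of_pos hn0 _) μ hμ P X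
    hX hindep (fun x => W (ProjOT.empiricalMeasure x) μ) hfin hlip
  refine ⟨fun ω => hfin _, h1, fun t ht => (h2 t ht).trans_eq ?_⟩
  -- With `c = n ^ (-1/p)`, the denominator `2 (n (2cσ)² + t (2cV))` equals `8 σ² n c² + 4 t V c`.
  have hpow : (n : ℝ) ^ (1 - 2 / p) = n * ((n : ℝ) ^ (-(1 / p))) ^ 2 := by
    rw [← Real.rpow_natCast, ← Real.rpow_mul hn0.le, sub_eq_add_neg, Real.rpow_add hn0,
      Real.rpow_one]
    congr 2
    push_cast
    ring
  rw [hpow]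
  congr 4
  ring
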